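/- Let $X$ be a separable Banach space over $\mathbb{R}$ or $\mathbb{C}$ whose dual $X^*$ is non-separable in the norm topology. Then for every $\delta>0$ there is a closed linear subspace $Y\subseteq X$ such that the dual $(X/Y)^*$ of the quotient Banach space $X/Y$ is non-separable in the norm topology and $X/Y$ has a (Schauder) basis with basis constant not exceeding $1+\delta$. Here the basis constant of a basis $(e_n)_{n\ge 0}$ with coordinate functionals $(e_n^*)_{n\ge 0}$ is $\sup_{n}\|P_n\|$, where $P_n x=\sum_{i<n}e_i^*(x)\,e_i$. -/

import Mathlib

/-!
A separable `X` with non-separable dual has a nonempty bounded set `K` of functionals in which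
every member is a weak-* limit of members at distance more than a fixed `ε`; conversely, by Baire,
such a set forces the dual to be non-separable. One grows inside a thickening of `K` an infinitely
branching tree `h 0, h 1, …` of functionals, together with finite-dimensional subspaces
`E 0 ≤ E 1 ≤ ⋯` with dense union, such that `h (n + 1)` agrees with its parent on `E n`, is far
from it on `E (n + 1)`, and, by Helly, every vector shares its values under `h 0, …, h n` with a
vector of `E n` of almost the same length.

Let `Y` be the common kernel of all `h n`. The tree descends to `X ⧸ Y`, where its nodes are again
weak-* limits of distant nodes, so that `(X ⧸ Y)*` is non-separable. On the image of `E n` every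
`h m` is determined by `h 1, …, h n`, so this image has dimension `n`, and Helly's property of
`E n` turns into a projection onto it of norm close to one. These projections commute and converge
pointwise to the identity, hence are the partial sum projections of a basis.
-/

open Bornology Filter Metric Set TopologicalSpace Topology
open scoped ENNReal NNReal

theorem exists_uncountable_isBounded_isSeparated {T : Type*} [PseudoMetricSpace T]
    (hT : ¬ SeparableSpace T) :
    ∃ ε : ℝ≥0, 0 < ε ∧ ∃ A : Set T, ¬ A.Countable ∧ IsBounded A ∧ IsSeparated ε A := by
  by_contra! H
  refine hT (@SecondCountableTopology.to_separableSpace T _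
    (EMetric.secondCountable_of_almost_dense_set fun r hr => ?_))
  obtain ⟨ε, hε, hεr⟩ := ENNReal.lt_iff_exists_nnreal_btwn.1 hr
  obtain ⟨S, hS⟩ := zorn_subset {S : Set T | S ⊆ univ ∧ IsSeparated ε S} fun c hc hchain =>
    ⟨⋃₀ c, ⟨subset_univ _, (pairwise_sUnion hchain.directedOn).2 fun s hs => (hc hs).2⟩,
      fun s hs => subset_sUnion_of_mem hs⟩
  have hcover : IsCover ε univ S := .of_maximal_isSeparated hS
  refine ⟨S, ?_, ?_⟩
  · rcases isEmpty_or_nonempty T with _ | ⟨⟨x⟩⟩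
    · exact S.to_countable
    have hSball : S = ⋃ n : ℕ, S ∩ closedBall x n := by
      rw [← inter_iUnion, iUnion_closedBall_nat, inter_univ]
    rw [hSball]
    refine countable_iUnion fun n => by_contra fun hn => ?_
    exact H ε (by simpa using hε) _ hn (isBounded_closedBall.subset inter_subset_right)
      (hS.prop.2.subset inter_subset_left)
  · refine eq_univ_of_univ_subset ((isCover_iff_subset_iUnion_closedEBall.1 hcover).trans ?_)
    exact iUnion₂_mono fun x _ => closedEBall_subset_closedEBall hεr.le

theorem countable_setOf_exists_countable_mem_nhdsWithin {T : Type*} [TopologicalSpace T]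
    {A : Set T} (hA : IsHereditarilyLindelof A) :
    {x ∈ A | ∃ U ∈ 𝓝[A] x, U.Countable}.Countable := by
  refine (hA _ (sep_subset _ _)).induction_on (p := Set.Countable)
    (fun _ _ hst ht => Countable.mono hst ht) (fun S hS h => hS.sUnion h) fun x hx => ?_
  obtain ⟨U, hU, hUc⟩ := hx.2
  exact ⟨U, nhdsWithin_mono x (sep_subset _ _) hU, hUc⟩

section Dual

variable {𝕜 V : Type*} [NontriviallyNormedField 𝕜] [SeminormedAddCommGroup V] [NormedSpace 𝕜 V]
  {ε : ℝ} {K : Set (StrongDual 𝕜 V)}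

theorem isHereditarilyLindelof_toWeakDual_image [ProperSpace 𝕜] [SeparableSpace V]
    (hK : IsBounded K) :
    IsHereditarilyLindelof (StrongDual.toWeakDual '' K) := by
  obtain ⟨R, hR⟩ := hK.subset_closedBall 0
  let B := WeakDual.toStrongDual ⁻¹' closedBall (0 : StrongDual 𝕜 V) R
  have hB : IsCompact B := WeakDual.isCompact_closedBall 0 R
  have : CompactSpace B := isCompact_iff_compactSpace.1 hB
  have : MetrizableSpace B := WeakDual.metrizable_of_isCompact 𝕜 V B hB
  let := metrizableSpaceMetric B
  intro S hS
  have hSB : S ⊆ B := by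
    intro x hx
    obtain ⟨f, hf, rfl⟩ := hS hx
    exact hR hf
  have := (HereditarilyLindelofSpace.isLindelof ((↑) ⁻¹' S : Set B)).image continuous_subtype_val
  rwa [Subtype.image_preimage_coe, inter_eq_right.2 hSB] at this

/-- A set `K` of functionals is `ε`-unfragmented when every `f ∈ K` is a weak-* limit of members of
`K` at norm distance more than `ε` from `f`. -/
def IsUnfragmented (ε : ℝ) (K : Set (StrongDual 𝕜 V)) : Prop :=
  ∀ f ∈ K, StrongDual.toWeakDual f ∈ closure (StrongDual.toWeakDual '' {f' ∈ K | ε < dist f' f})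

theorem IsUnfragmented.image_sub_right (hK : IsUnfragmented ε K) (f₀ : StrongDual 𝕜 V) :
    IsUnfragmented ε ((· - f₀) '' K) := by
  rintro _ ⟨f, hf, rfl⟩
  have hcont : Continuous fun w : WeakDual 𝕜 V => w - StrongDual.toWeakDual f₀ := by fun_prop
  rw [map_sub]
  refine closure_mono ?_ (image_closure_subset_closure_image hcont (mem_image_of_mem _ (hK f hf)))
  rintro _ ⟨_, ⟨f', ⟨hf'K, hf'⟩, rfl⟩, rfl⟩
  exact ⟨f' - f₀, ⟨mem_image_of_mem _ hf'K, by simpa using hf'⟩, map_sub _ _ _⟩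

theorem exists_isUnfragmented_isBounded [ProperSpace 𝕜] [SeparableSpace V]
    (hV : ¬ SeparableSpace (StrongDual 𝕜 V)) :
    ∃ ε > 0, ∃ K : Set (StrongDual 𝕜 V), K.Nonempty ∧ IsBounded K ∧ IsUnfragmented ε K := by
  obtain ⟨ε, hε, A, hA, hAb, hAsep⟩ := exists_uncountable_isBounded_isSeparated hV
  let W := StrongDual.toWeakDual '' A
  let B := StrongDual.toWeakDual ⁻¹' {w ∈ W | ∃ U ∈ 𝓝[W] w, U.Countable}
  have hB : B.Countable := (countable_setOf_exists_countable_mem_nhdsWithin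
    (isHereditarilyLindelof_toWeakDual_image hAb)).preimage StrongDual.toWeakDual.injective
  refine ⟨ε, hε, A \ B, ?_, hAb.subset sdiff_subset, fun f hf => ?_⟩
  · rw [sdiff_nonempty]
    exact fun hAB => hA (hB.mono hAB)
  rw [mem_closure_iff_nhds]
  intro U hU
  have hunc : ¬ (W ∩ U).Countable := fun hc =>
    hf.2 ⟨mem_image_of_mem _ hf.1, W ∩ U, inter_mem_nhdsWithin W hU, hc⟩
  obtain ⟨_, ⟨⟨f', hf'A, rfl⟩, hf'U⟩, hf'⟩ :
      ∃ w ∈ W ∩ U, w ∉ StrongDual.toWeakDual '' insert f B := by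
    by_contra! H
    exact hunc (((hB.insert f).image _).mono H)
  have hf'fB : f' ∉ insert f B := fun h => hf' (mem_image_of_mem _ h)
  rw [mem_insert_iff, not_or] at hf'fB
  refine ⟨_, hf'U, f', ⟨⟨hf'A, hf'fB.2⟩, ?_⟩, rfl⟩
  have : (ε : ℝ≥0∞) < edist f' f := hAsep hf'A hf.1 hf'fB.1
  rwa [edist_nndist, ENNReal.coe_lt_coe, ← NNReal.coe_lt_coe, coe_nndist] at this

theorem not_separableSpace_strongDual_of_isUnfragmented [ProperSpace 𝕜] (hε : 0 < ε)
    (hKne : K.Nonempty) (hKb : IsBounded K) (hK : IsUnfragmented ε K) :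
    ¬ SeparableSpace (StrongDual 𝕜 V) := by
  intro _
  let W := StrongDual.toWeakDual '' K
  let L := closure W
  have hWb : IsBounded W := WeakDual.isBounded_toWeakDual_preimage_iff_isBounded.1
    (by rwa [preimage_image_eq _ StrongDual.toWeakDual.injective])
  have : CompactSpace L := isCompact_iff_compactSpace.1
    (WeakDual.isCompact_of_bounded_of_closed (WeakDual.isBounded_closure hWb) isClosed_closure)
  have : Nonempty L := (hKne.image _).closure.to_subtype
  -- If the dual were separable, countably many closed balls of radius `ε / 2` would cover the
  -- weak-* compact set `L`, so by Baire one of them would contain a weak-* open piece of `K`.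
  let ball : ℕ → Set L := fun n =>
    (↑) ⁻¹' (WeakDual.toStrongDual ⁻¹' closedBall (denseSeq (StrongDual 𝕜 V) n) (ε / 2))
  obtain ⟨n, ⟨w, hwW⟩, hw⟩ := nonempty_interior_of_iUnion_of_closed (f := ball)
    (fun n => (WeakDual.isClosed_closedBall _ _).preimage continuous_subtype_val) (by
      refine eq_univ_of_forall fun w => mem_iUnion.2 ?_
      obtain ⟨n, hn⟩ := (denseRange_denseSeq _).exists_dist_lt
        (WeakDual.toStrongDual (w : WeakDual 𝕜 V)) (half_pos hε)
      exact ⟨n, hn.le⟩)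
  obtain ⟨U, hU, hUball⟩ := mem_nhds_subtype _ _ _ |>.1 (mem_interior_iff_mem_nhds.1 hw)
  obtain ⟨U', hU'U, hU', hwU'⟩ := mem_nhds_iff.1 hU
  have hmem : ∀ f ∈ K, StrongDual.toWeakDual f ∈ U' → f ∈ closedBall (denseSeq _ n) (ε / 2) :=
    fun f hf hfU => hUball (a := ⟨_, subset_closure (mem_image_of_mem _ hf)⟩) (hU'U hfU)
  obtain ⟨_, hfU, f, hf, rfl⟩ := mem_closure_iff.1 hwW U' hU' hwU'
  obtain ⟨_, hf'U, f', ⟨hf'K, hf'⟩, rfl⟩ := mem_closure_iff.1 (hK f hf) U' hU' hfU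
  have := dist_triangle_right f' f (denseSeq (StrongDual 𝕜 V) n)
  have hfball := mem_closedBall.1 (hmem f hf hfU)
  have hf'ball := mem_closedBall.1 (hmem f' hf'K hf'U)
  linarith

end Dual

section NormedDual

variable {𝕜 : Type*} [RCLike 𝕜] {V : Type*} [NormedAddCommGroup V] [NormedSpace 𝕜 V]
  {ε : ℝ} {K : Set (StrongDual 𝕜 V)}

theorem exists_norm_lt_eqOn_of_mem_closure {f : StrongDual 𝕜 V}
    (hf : StrongDual.toWeakDual f ∈ closure (StrongDual.toWeakDual '' K)) (E : Submodule 𝕜 V)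
    [FiniteDimensional 𝕜 E] {η : ℝ} (hη : 0 < η) :
    ∃ f' ∈ K, ∃ k : StrongDual 𝕜 V, ‖k‖ < η ∧ ∀ y ∈ E, k y = f' y - f y := by
  let b := Module.finBasis 𝕜 E
  obtain ⟨C, hC, hbC⟩ := b.exists_opNorm_le (F := 𝕜)
  have hη' : 0 < η / (2 * C) := by positivity
  have hnhds : {w : WeakDual 𝕜 V | ∀ i, ‖w (b i) - f (b i)‖ < η / (2 * C)} ∈
      𝓝 (StrongDual.toWeakDual f) := by
    refine eventually_all.2 fun i => ?_
    have hcont : Continuous fun w : WeakDual 𝕜 V => ‖w (b i) - f (b i)‖ :=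
      ((WeakDual.eval_continuous (b i : V)).sub continuous_const).norm
    exact hcont.continuousAt.eventually (gt_mem_nhds (by simpa using hη'))
  obtain ⟨_, hf', f', hf'K, rfl⟩ := mem_closure_iff_nhds.1 hf _ hnhds
  obtain ⟨k, hk, hknorm⟩ := exists_extension_norm_eq E ((f' - f).comp E.subtypeL)
  refine ⟨f', hf'K, k, ?_, fun y hy => hk ⟨y, hy⟩⟩
  calc ‖k‖ = ‖(f' - f).comp E.subtypeL‖ := hknorm
    _ ≤ C * (η / (2 * C)) := hbC hη'.le fun i => (hf' i).le
    _ < η := by field_simp; norm_num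

theorem IsUnfragmented.exists_mem_thickening (hK : IsUnfragmented ε K) (hε : 0 < ε) {δ : ℝ}
    {h : StrongDual 𝕜 V} (hh : h ∈ thickening δ K) (E : Submodule 𝕜 V) [FiniteDimensional 𝕜 E] :
    ∃ h' ∈ thickening δ K, (∀ y ∈ E, h' y = h y) ∧ ε / 2 < ‖h' - h‖ := by
  obtain ⟨f, hf, hhf⟩ := mem_thickening_iff.1 hh
  rw [dist_eq_norm] at hhf
  obtain ⟨f', ⟨hf'K, hf'⟩, k, hk, hkE⟩ := exists_norm_lt_eqOn_of_mem_closure (hK f hf) E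
    (lt_min (sub_pos.2 hhf) (half_pos hε))
  rw [dist_eq_norm] at hf'
  rw [lt_min_iff] at hk
  -- The summand `-k` makes the agreement on `E` exact; the thickening leaves room for it.
  refine ⟨h + (f' - f - k), mem_thickening_iff.2 ⟨f', hf'K, ?_⟩, fun y hy => ?_, ?_⟩
  · calc dist (h + (f' - f - k)) f' = ‖(h - f) - k‖ := by rw [dist_eq_norm]; congr 1; abel
      _ ≤ ‖h - f‖ + ‖k‖ := norm_sub_le _ _
      _ < δ := by linarith
  · simp [hkE y hy]
  · rw [add_sub_cancel_left]
    linarith [norm_sub_norm_le (f' - f) k]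

end NormedDual

theorem tendsto_apply_of_tendsto_apply_dense {𝕜 E F : Type*} [NontriviallyNormedField 𝕜]
    [SeminormedAddCommGroup E] [NormedSpace 𝕜 E] [SeminormedAddCommGroup F] [NormedSpace 𝕜 F]
    {ι : Type*} {l : Filter ι} {T : ι → E →L[𝕜] F} {T₀ : E →L[𝕜] F}
    {R : ℝ} (hT : ∀ i, ‖T i‖ ≤ R) {D : Set E} (hD : Dense D)
    (h : ∀ x ∈ D, Tendsto (fun i => T i x) l (𝓝 (T₀ x))) (x : E) :
    Tendsto (fun i => T i x) l (𝓝 (T₀ x)) := by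
  have hequi : Equicontinuous ((↑) ∘ T) :=
    ((NormedSpace.equicontinuous_TFAE (σ₁₂ := RingHom.id 𝕜) T).out 5 1 (h₁ := rfl) (h₂ := rfl)).1
      ⟨R, hT⟩
  exact (hequi x).tendsto_of_mem_closure T₀.continuous.continuousWithinAt h (hD x)

section Interpolation

variable {𝕜 V : Type*} [NontriviallyNormedField 𝕜] [SeminormedAddCommGroup V] [NormedSpace 𝕜 V]

/-- Every vector `x` can be replaced by a vector of `E` which has the same values under the
functionals of `S` and is at most `C` times as long. By Helly's theorem, a finite `S` admits such
a finite-dimensional `E` as soon as `1 < C`. -/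
def IsInterpolating (C : ℝ) (S : Set (StrongDual 𝕜 V)) (E : Submodule 𝕜 V) : Prop :=
  ∀ x, ∃ y ∈ E, (∀ g ∈ S, g y = g x) ∧ ‖y‖ ≤ C * ‖x‖

variable {C : ℝ} {S : Set (StrongDual 𝕜 V)} {E E' : Submodule 𝕜 V}

namespace IsInterpolating

theorem mono (h : IsInterpolating C S E) (hE : E ≤ E') : IsInterpolating C S E' := fun x =>
  let ⟨y, hy, hyx⟩ := h x
  ⟨y, hE hy, hyx⟩

theorem map_mkQ (h : IsInterpolating C S E) (hC : 0 < C) {C' : ℝ} (hCC' : C < C')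
    (Y : Submodule 𝕜 V) {S' : Set (StrongDual 𝕜 (V ⧸ Y))} (hS' : ∀ g ∈ S', g.comp Y.mkQL ∈ S) :
    IsInterpolating C' S' (E.map Y.mkQ) := by
  intro v
  rcases (norm_nonneg v).eq_or_lt with hv | hv
  · refine ⟨0, Submodule.zero_mem _, fun g _ => ?_, by simp [← hv]⟩
    rw [map_zero, eq_comm, ← norm_le_zero_iff]
    simpa [← hv] using g.le_opNorm v
  obtain ⟨x, rfl, hx⟩ := Submodule.Quotient.norm_mk_lt v (ε := (C' - C) / C * ‖v‖)
    (mul_pos (div_pos (sub_pos.2 hCC') hC) hv)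
  obtain ⟨y, hy, hyS, hyx⟩ := h x
  refine ⟨Y.mkQ y, Submodule.mem_map_of_mem hy, fun g hg => hyS _ (hS' g hg), ?_⟩
  calc ‖Y.mkQ y‖ ≤ ‖y‖ := Submodule.Quotient.norm_mk_le Y y
    _ ≤ C * ‖x‖ := hyx
    _ ≤ C * (_ + (C' - C) / C * _) := by gcongr
    _ = C' * _ := by field_simp; ring

theorem exists_projection (h : IsInterpolating C S E) (hC : 0 ≤ C)
    (hE : ∀ v ∈ E, (∀ g ∈ S, g v = 0) → v = 0) :
    ∃ P : V →L[𝕜] V, (∀ x, P x ∈ E) ∧ (∀ x, ∀ g ∈ S, g (P x) = g x) ∧ ‖P‖ ≤ C := by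
  choose P hPE hPS hPC using h
  have huniq : ∀ {x y}, x ∈ E → y ∈ E → (∀ g ∈ S, g x = g y) → x = y := fun hx hy hxy =>
    sub_eq_zero.1 (hE _ (E.sub_mem hx hy) fun g hg => by rw [map_sub, hxy g hg, sub_self])
  refine ⟨LinearMap.mkContinuous
    { toFun := P
      map_add' := fun x y => huniq (hPE _) (E.add_mem (hPE x) (hPE y)) fun g hg => ?_
      map_smul' := fun a x => huniq (hPE _) (E.smul_mem a (hPE x)) fun g hg => ?_ } C hPC,
    hPE, hPS, LinearMap.mkContinuous_norm_le _ hC hPC⟩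
  · simp only [map_add, hPS _ g hg]
  · simp only [map_smul, hPS _ g hg, RingHom.id_apply]

end IsInterpolating

theorem exists_schauderBasis_proj_eq {𝕜 V : Type*} [NontriviallyNormedField 𝕜]
    [NormedAddCommGroup V] [NormedSpace 𝕜 V] {P : ℕ → V →L[𝕜] V}
    (hrank : ∀ n, Module.finrank 𝕜 (P n).toLinearMap.range = n)
    (hcomp : ∀ n m x, P n (P m x) = P (min n m) x)
    (hlim : ∀ x, Tendsto (fun n => P n x) atTop (𝓝 x)) :
    ∃ b : SchauderBasis 𝕜 V, b.proj = P := by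
  have hP0 : P 0 = 0 := by
    have : FiniteDimensional 𝕜 (P 1).toLinearMap.range := .of_finrank_pos (by simp [hrank])
    have hle : (P 0).toLinearMap.range ≤ (P 1).toLinearMap.range := by
      rintro _ ⟨x, rfl⟩
      exact ⟨P 0 x, hcomp 1 0 x⟩
    have : FiniteDimensional 𝕜 (P 0).toLinearMap.range := Submodule.finiteDimensional_of_le hle
    have hbot := Submodule.finrank_eq_zero.1 (hrank 0)
    exact ContinuousLinearMap.coe_injective (LinearMap.range_eq_bot.1 hbot)
  have hstep : ∀ n, ∃ e ∈ (SchauderBasis.succSub P n).toLinearMap.range, e ≠ 0 := fun n =>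
    Submodule.exists_mem_ne_zero_of_ne_bot fun hbot => by
      have := SchauderBasis.finrank_range_succSub_eq_one hrank hcomp n
      rw [hbot, finrank_bot] at this
      exact zero_ne_one this
  choose e he he0 using hstep
  let D : SchauderBasis.RankOneDecomposition 𝕜 V := ⟨P, e, hP0, hrank, hcomp, hlim, he, he0⟩
  exact ⟨D.basis, D.basis_proj⟩

theorem exists_schauderBasis_of_isInterpolating {𝕜 V : Type*} [NontriviallyNormedField 𝕜]
    [NormedAddCommGroup V] [NormedSpace 𝕜 V] {C : ℝ} (hC : 0 ≤ C)
    {S : ℕ → Set (StrongDual 𝕜 V)} {F : ℕ → Submodule 𝕜 V} (hS : Monotone S) (hF : Monotone F)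
    (hSF : ∀ n, IsInterpolating C (S n) (F n))
    (hinj : ∀ n, ∀ v ∈ F n, (∀ g ∈ S n, g v = 0) → v = 0)
    (hrank : ∀ n, Module.finrank 𝕜 (F n) = n) (hdense : Dense (⋃ n, (F n : Set V))) :
    ∃ b : SchauderBasis 𝕜 V, b.enormProjBound ≤ ENNReal.ofReal C := by
  choose P hPF hPS hPC using fun n => (hSF n).exists_projection hC (hinj n)
  have hP : ∀ {n x y}, y ∈ F n → (∀ g ∈ S n, g y = g x) → P n x = y := fun {n x y} hy hyx =>
    sub_eq_zero.1 (hinj n _ ((F n).sub_mem (hPF n x) hy) fun g hg => by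
      rw [map_sub, hPS n x g hg, hyx g hg, sub_self])
  have hPid : ∀ {n x}, x ∈ F n → P n x = x := fun hx => hP hx fun _ _ => rfl
  have hPrange : ∀ n, (P n).toLinearMap.range = F n := fun n =>
    le_antisymm (by rintro _ ⟨x, rfl⟩; exact hPF n x) fun x hx => ⟨x, hPid hx⟩
  have hPcomp : ∀ n m x, P n (P m x) = P (min n m) x := fun n m x => by
    rcases le_total n m with hnm | hmn
    · rw [min_eq_left hnm]
      exact hP (hPF n x) fun g hg => by rw [hPS n x g hg, hPS m x g (hS hnm hg)]
    · rw [min_eq_right hmn]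
      exact hPid (hF hmn (hPF m x))
  have hPlim : ∀ x, Tendsto (fun n => P n x) atTop (𝓝 x) := by
    refine tendsto_apply_of_tendsto_apply_dense (T₀ := .id 𝕜 V) hPC hdense fun x hx => ?_
    obtain ⟨n, hn⟩ := mem_iUnion.1 hx
    exact tendsto_const_nhds.congr' ((eventually_ge_atTop n).mono fun m hm =>
      (hPid (hF hm hn)).symm)
  obtain ⟨b, hb⟩ := exists_schauderBasis_proj_eq (fun n => by rw [hPrange, hrank]) hPcomp hPlim
  refine ⟨b, iSup_le fun n => ?_⟩
  rw [hb, ← ofReal_norm]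
  exact ENNReal.ofReal_le_ofReal (hPC n)

end Interpolation

section FiniteDimensional

variable {𝕜 : Type*} [RCLike 𝕜] {V : Type*} [SeminormedAddCommGroup V] [NormedSpace 𝕜 V]

theorem exists_finiteDimensional_preimage_norm_le_mul_norm_apply {W : Type*}
    [NormedAddCommGroup W] [NormedSpace 𝕜 W] [FiniteDimensional 𝕜 W] (T : V →L[𝕜] W) :
    ∃ G : Submodule 𝕜 V, FiniteDimensional 𝕜 G ∧
      ∃ M, 0 ≤ M ∧ ∀ x, ∃ y ∈ G, T y = T x ∧ ‖y‖ ≤ M * ‖T x‖ := by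
  obtain ⟨σ, hσ⟩ := T.toLinearMap.rangeRestrict.exists_rightInverse_of_surjective
    T.toLinearMap.range_rangeRestrict
  let σL := LinearMap.toContinuousLinearMap σ
  refine ⟨σ.range, inferInstance, ‖σL‖, norm_nonneg _, fun x => ?_⟩
  let q := T.toLinearMap.rangeRestrict x
  exact ⟨σ q, ⟨q, rfl⟩, congr_arg Subtype.val (LinearMap.congr_fun hσ q), σL.le_opNorm q⟩

theorem exists_finiteDimensional_preimage_norm_le_of_norm_le_one {W : Type*}
    [NormedAddCommGroup W] [NormedSpace 𝕜 W] [FiniteDimensional 𝕜 W] (T : V →L[𝕜] W) {C : ℝ}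
    (hC : 1 < C) :
    ∃ E : Submodule 𝕜 V, FiniteDimensional 𝕜 E ∧
      ∀ x, ‖x‖ ≤ 1 → ∃ y ∈ E, T y = T x ∧ ‖y‖ ≤ C := by
  have : ProperSpace W := FiniteDimensional.proper_rclike 𝕜 W
  obtain ⟨G, _, M, hM, hG⟩ := exists_finiteDimensional_preimage_norm_le_mul_norm_apply T
  have hη : 0 < (C - 1) / (M + 1) := div_pos (sub_pos.2 hC) (by positivity)
  have hMη : M * ((C - 1) / (M + 1)) ≤ C - 1 := by
    rw [mul_div_left_comm]
    exact mul_le_of_le_one_right (sub_pos.2 hC).le (div_le_one_of_le₀ (by linarith) (by positivity))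
  -- Finitely many vectors `c w` of the unit ball give an approximation to `T x`, and the small
  -- error is corrected by a vector of `G`, which is small as well.
  have hball : TotallyBounded (T '' closedBall 0 1) :=
    (T.lipschitz.isBounded_image isBounded_closedBall).isCompact_closure.totallyBounded.subset
      subset_closure
  obtain ⟨t, htball, htfin, hcover⟩ := finite_approx_of_totallyBounded hball _ hη
  have hpreimage : ∀ w ∈ t, ∃ x ∈ closedBall 0 1, T x = w := htball
  choose! c hc hTc using hpreimage
  have := FiniteDimensional.span_of_finite 𝕜 (htfin.image c)
  refine ⟨Submodule.span 𝕜 (c '' t) ⊔ G, inferInstance, fun x hx => ?_⟩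
  obtain ⟨w, hw, hxw⟩ :=
    mem_iUnion₂.1 (hcover (mem_image_of_mem T (mem_closedBall_zero_iff.2 hx)))
  obtain ⟨y, hy, hTy, hyM⟩ := hG (x - c w)
  rw [map_sub, hTc w hw] at hTy hyM
  refine ⟨c w + y, Submodule.add_mem_sup
    (Submodule.subset_span (mem_image_of_mem c hw)) hy, ?_, ?_⟩
  · rw [map_add, hTc w hw, hTy, add_sub_cancel]
  · calc ‖c w + y‖ ≤ ‖c w‖ + ‖y‖ := norm_add_le _ _
      _ ≤ 1 + M * ((C - 1) / (M + 1)) :=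
        add_le_add (mem_closedBall_zero_iff.1 (hc w hw)) (hyM.trans
          (mul_le_mul_of_nonneg_left ((dist_eq_norm _ w).symm.trans_le (mem_ball.1 hxw).le) hM))
      _ ≤ C := by linarith

theorem exists_finiteDimensional_preimage_norm_le {W : Type*} [NormedAddCommGroup W]
    [NormedSpace 𝕜 W] [FiniteDimensional 𝕜 W] (T : V →L[𝕜] W) {C : ℝ} (hC : 1 < C) :
    ∃ E : Submodule 𝕜 V, FiniteDimensional 𝕜 E ∧ ∀ x, ∃ y ∈ E, T y = T x ∧ ‖y‖ ≤ C * ‖x‖ := by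
  obtain ⟨E, hE, h⟩ := exists_finiteDimensional_preimage_norm_le_of_norm_le_one T hC
  refine ⟨E, hE, fun x => ?_⟩
  rcases (norm_nonneg x).eq_or_lt with hx | hx
  · refine ⟨0, Submodule.zero_mem _, ?_, by simp [← hx]⟩
    rw [map_zero, eq_comm, ← norm_le_zero_iff]
    simpa [← hx] using T.le_opNorm x
  obtain ⟨y, hy, hTy, hyC⟩ := h ((‖x‖⁻¹ : 𝕜) • x) (by simp [norm_smul, hx.ne'])
  refine ⟨(‖x‖ : 𝕜) • y, Submodule.smul_mem _ _ hy, ?_, ?_⟩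
  · rw [map_smul, hTy, ← map_smul, smul_inv_smul₀ (by exact_mod_cast hx.ne')]
  · rw [norm_smul, RCLike.norm_ofReal, abs_of_pos hx, mul_comm]
    gcongr

theorem exists_finiteDimensional_isInterpolating {C : ℝ} (hC : 1 < C) {S : Set (StrongDual 𝕜 V)}
    (hS : S.Finite) :
    ∃ E : Submodule 𝕜 V, FiniteDimensional 𝕜 E ∧ IsInterpolating C S E := by
  have := hS.fintype
  obtain ⟨E, hE, h⟩ := exists_finiteDimensional_preimage_norm_le
    (ContinuousLinearMap.pi fun g : S => (g : StrongDual 𝕜 V)) hC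
  refine ⟨E, hE, fun x => ?_⟩
  obtain ⟨y, hy, hTy, hyx⟩ := h x
  exact ⟨y, hy, fun g hg => congr_fun hTy ⟨g, hg⟩, hyx⟩

end FiniteDimensional

theorem exists_seq_of_forall_history_exists {α : Type*} {r : ∀ n, (Fin (n + 1) → α) → α → Prop}
    (hr : ∀ n s, ∃ a, r n s a) (a₀ : α) :
    ∃ u : ℕ → α, u 0 = a₀ ∧ ∀ n, r n (fun i => u i) (u (n + 1)) := by
  choose next hnext using hr
  let step : ∀ n, (∀ m < n, α) → α
    | 0, _ => a₀
    | n + 1, s => next n fun i => s i i.isLt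
  let u : ℕ → α := fun n => n.strongRec step
  have hu : ∀ n, u (n + 1) = next n fun i => u i := fun n => Nat.strongRec_eq step (n + 1)
  refine ⟨u, Nat.strongRec_eq step 0, fun n => ?_⟩
  rw [hu]
  exact hnext n _

theorem image_Iic_add_one {α : Type*} (u : ℕ → α) (n : ℕ) :
    u '' Iic (n + 1) = insert (u (n + 1)) (range fun i : Fin (n + 1) => u i) := by
  ext a
  simp [Fin.exists_iff, Nat.le_succ_iff_eq_or_le, or_and_right, exists_or, eq_comm]

/-- The functionals `h n` form a tree with root `h 0 = 0` in which the parent of the node `n + 1` is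
the node `n.unpair.1`, so that `n` has the infinitely many children `Nat.pair n k + 1`. A node
agrees with its parent on the subspace `E n` built so far, but differs from it by more than `ε` in
norm, as is seen on the next subspace. The subspaces `E n` exhaust `V` up to closure, and `E n`
realizes the restrictions of all vectors to `h 0, …, h n` at the cost of a factor `C` in norm. -/
structure IsDispersingTree {𝕜 V : Type*} [NontriviallyNormedField 𝕜] [SeminormedAddCommGroup V]
    [NormedSpace 𝕜 V] (ε R C : ℝ) (h : ℕ → StrongDual 𝕜 V) (E : ℕ → Submodule 𝕜 V) : Prop where
  root : h 0 = 0
  norm_le : ∀ n, ‖h n‖ ≤ R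
  monotone : Monotone E
  dense : Dense (⋃ n, (E n : Set V))
  eqOn : ∀ n, ∀ y ∈ E n, h (n + 1) y = h n.unpair.1 y
  exists_lt_norm : ∀ n, ∃ x ∈ E (n + 1), ‖x‖ ≤ 1 ∧ ε < ‖(h (n + 1) - h n.unpair.1) x‖
  isInterpolating : ∀ n, IsInterpolating C (h '' Iic n) (E n)

section Existence

variable {𝕜 : Type*} [RCLike 𝕜] {V : Type*} [NormedAddCommGroup V] [NormedSpace 𝕜 V]

theorem IsUnfragmented.exists_isInterpolating {ε δ C : ℝ} {K S : Set (StrongDual 𝕜 V)}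
    (hK : IsUnfragmented ε K) (hε : 0 < ε) (hC : 1 < C) (hS : S.Finite) {h : StrongDual 𝕜 V}
    (hh : h ∈ thickening δ K) (E : Submodule 𝕜 V) [FiniteDimensional 𝕜 E] (z : V) :
    ∃ h' ∈ thickening δ K, ∃ E' : Submodule 𝕜 V, FiniteDimensional 𝕜 E' ∧ E ≤ E' ∧ z ∈ E' ∧
      (∀ y ∈ E, h' y = h y) ∧ (∃ x ∈ E', ‖x‖ ≤ 1 ∧ ε / 2 < ‖(h' - h) x‖) ∧
      IsInterpolating C (insert h' S) E' := by
  obtain ⟨h', hh', hE, hgap⟩ := hK.exists_mem_thickening hε hh E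
  obtain ⟨x, hx, hxgap⟩ := (h' - h).exists_lt_apply_of_lt_opNorm hgap
  obtain ⟨G, _, hG⟩ := exists_finiteDimensional_isInterpolating hC (hS.insert h')
  have := FiniteDimensional.span_of_finite 𝕜 (toFinite {x, z})
  have hspan : ∀ w ∈ ({x, z} : Set V), w ∈ E ⊔ G ⊔ Submodule.span 𝕜 {x, z} := fun w hw =>
    le_sup_right (a := E ⊔ G) (Submodule.subset_span hw)
  exact ⟨h', hh', E ⊔ G ⊔ Submodule.span 𝕜 {x, z}, inferInstance,
    le_sup_of_le_left le_sup_left, hspan z (mem_insert_of_mem x rfl), hE,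
    ⟨x, hspan x (mem_insert x _), hx.le, hxgap⟩, hG.mono (le_sup_of_le_left le_sup_right)⟩

theorem IsUnfragmented.exists_isDispersingTree [SeparableSpace V] {ε R C : ℝ}
    {K : Set (StrongDual 𝕜 V)} (hK : IsUnfragmented ε K) (hε : 0 < ε) (hC : 1 < C) (hK0 : 0 ∈ K)
    (hKR : ∀ f ∈ thickening 1 K, ‖f‖ ≤ R) :
    ∃ (h : ℕ → StrongDual 𝕜 V) (E : ℕ → Submodule 𝕜 V), IsDispersingTree (ε / 2) R C h E := by
  let α := {p : StrongDual 𝕜 V × Submodule 𝕜 V // p.1 ∈ thickening 1 K ∧ FiniteDimensional 𝕜 p.2}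
  let root : α := ⟨(0, ⊥), self_subset_thickening one_pos K hK0, inferInstance⟩
  obtain ⟨u, hu0, hu⟩ := exists_seq_of_forall_history_exists (α := α)
    (r := fun n s q =>
      let parent := (s ⟨n.unpair.1, Nat.lt_succ_of_le n.unpair_left_le⟩).1.1
      let E := (s (Fin.last n)).1.2
      E ≤ q.1.2 ∧ denseSeq V n ∈ q.1.2 ∧ (∀ y ∈ E, q.1.1 y = parent y) ∧
      (∃ x ∈ q.1.2, ‖x‖ ≤ 1 ∧ ε / 2 < ‖(q.1.1 - parent) x‖) ∧
      IsInterpolating C (insert q.1.1 (range fun i => (s i).1.1)) q.1.2)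
    (fun n s => by
      have := (s (Fin.last n)).2.2
      obtain ⟨h', hh', E', hE', h⟩ := hK.exists_isInterpolating hε hC
        (finite_range fun i => (s i).1.1) (s ⟨n.unpair.1, Nat.lt_succ_of_le n.unpair_left_le⟩).2.1
        (s (Fin.last n)).1.2 (denseSeq V n)
      exact ⟨⟨(h', E'), hh', hE'⟩, h⟩) root
  choose hmono hdense heq hgap hinterp using hu
  refine ⟨fun n => (u n).1.1, fun n => (u n).1.2, by rw [hu0], fun n => hKR _ (u n).2.1,
    monotone_nat_of_le_succ hmono, (denseRange_denseSeq V).mono ?_, heq, hgap, fun n => ?_⟩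
  · rintro _ ⟨n, rfl⟩
    exact mem_iUnion.2 ⟨n + 1, hdense n⟩
  · cases n with
    | zero =>
      refine fun x => ⟨0, Submodule.zero_mem _, ?_, by rw [norm_zero]; positivity⟩
      simp [hu0, root]
    | succ n =>
      rw [image_Iic_add_one]
      exact hinterp n

theorem exists_isDispersingTree [SeparableSpace V] (hV : ¬ SeparableSpace (StrongDual 𝕜 V))
    {C : ℝ} (hC : 1 < C) :
    ∃ ε > 0, ∃ (R : ℝ) (h : ℕ → StrongDual 𝕜 V) (E : ℕ → Submodule 𝕜 V),
      IsDispersingTree ε R C h E := by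
  obtain ⟨ε, hε, K, ⟨f₀, hf₀⟩, hKb, hK⟩ := exists_isUnfragmented_isBounded hV
  have hK₀b : IsBounded ((· - f₀) '' K) :=
    (LipschitzWith.id.sub (LipschitzWith.const f₀)).isBounded_image hKb
  obtain ⟨R, hR⟩ := (hK₀b.thickening (δ := 1)).exists_norm_le
  exact ⟨ε / 2, half_pos hε, R,
    (hK.image_sub_right f₀).exists_isDispersingTree hε hC ⟨f₀, hf₀, sub_self f₀⟩ hR⟩

end Existence

theorem norm_liftQL_le {𝕜 V W : Type*} [NontriviallyNormedField 𝕜] [SeminormedAddCommGroup V]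
    [NormedSpace 𝕜 V] [SeminormedAddCommGroup W] [NormedSpace 𝕜 W] (Y : Submodule 𝕜 V)
    (f : V →L[𝕜] W) (hf : Y ≤ f.ker) : ‖Y.liftQL f hf‖ ≤ ‖f‖ := by
  refine ContinuousLinearMap.opNorm_le_bound _ (norm_nonneg f) fun v => ?_
  refine le_mul_of_forall_lt₀ fun a ha b hb => ?_
  obtain ⟨x, rfl, hx⟩ := Submodule.Quotient.norm_mk_lt v (sub_pos.2 hb)
  rw [add_sub_cancel] at hx
  calc ‖f x‖ ≤ ‖f‖ * ‖x‖ := f.le_opNorm x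
    _ ≤ a * b := mul_le_mul ha.le hx.le (norm_nonneg x) ((norm_nonneg f).trans ha.le)

namespace IsDispersingTree

variable {𝕜 : Type*} [NontriviallyNormedField 𝕜] {ε R C : ℝ}

section Seminormed

variable {V : Type*} [SeminormedAddCommGroup V] [NormedSpace 𝕜 V] {h : ℕ → StrongDual 𝕜 V}
  {E : ℕ → Submodule 𝕜 V}

theorem quotient (hT : IsDispersingTree ε R C h E) (hC : 0 < C) {C' : ℝ} (hCC' : C < C')
    (Y : Submodule 𝕜 V) (hY : ∀ n, Y ≤ (h n).ker) :
    IsDispersingTree ε R C' (fun n => Y.liftQL (h n) (hY n)) fun n => (E n).map Y.mkQ where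
  root := by
    ext v
    obtain ⟨x, rfl⟩ := Y.mkQ_surjective v
    simp [hT.root]
  norm_le n := (norm_liftQL_le Y (h n) (hY n)).trans (hT.norm_le n)
  monotone _ _ hmn := Submodule.map_mono (hT.monotone hmn)
  dense := by
    have := Y.mkQ_surjective.denseRange.dense_image Y.mkQL.continuous hT.dense
    rwa [image_iUnion] at this
  eqOn := by
    rintro n _ ⟨y, hy, rfl⟩
    exact hT.eqOn n y hy
  exists_lt_norm n := by
    obtain ⟨x, hx, hx1, hgap⟩ := hT.exists_lt_norm n
    exact ⟨Y.mkQ x, Submodule.mem_map_of_mem hx, (Submodule.Quotient.norm_mk_le Y x).trans hx1,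
      hgap⟩
  isInterpolating n := by
    refine (hT.isInterpolating n).map_mkQ hC hCC' Y ?_
    rintro _ ⟨i, hi, rfl⟩
    exact ⟨i, hi, rfl⟩

theorem tendsto_apply_child (hT : IsDispersingTree ε R C h E) (n : ℕ) (x : V) :
    Tendsto (fun k => h (Nat.pair n k + 1) x) atTop (𝓝 (h n x)) := by
  refine tendsto_apply_of_tendsto_apply_dense (fun k => hT.norm_le _) hT.dense (fun y hy => ?_) x
  obtain ⟨m, hm⟩ := mem_iUnion.1 hy
  refine tendsto_const_nhds.congr' ((eventually_ge_atTop m).mono fun k hk => ?_)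
  have := hT.eqOn (Nat.pair n k) y (hT.monotone (hk.trans (Nat.right_le_pair n k)) hm)
  rw [Nat.unpair_pair] at this
  exact this.symm

theorem isUnfragmented_range (hT : IsDispersingTree ε R C h E) : IsUnfragmented ε (range h) := by
  rintro _ ⟨n, rfl⟩
  have hlim : Tendsto (fun k => StrongDual.toWeakDual (h (Nat.pair n k + 1))) atTop
      (𝓝 (StrongDual.toWeakDual (h n))) :=
    tendsto_iff_forall_eval_tendsto_topDualPairing.2 (hT.tendsto_apply_child n)
  refine mem_closure_of_tendsto hlim (.of_forall fun k => ⟨_, ⟨mem_range_self _, ?_⟩, rfl⟩)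
  obtain ⟨x, -, hx, hgap⟩ := hT.exists_lt_norm (Nat.pair n k)
  rw [Nat.unpair_pair] at hgap
  rw [dist_eq_norm]
  exact hgap.trans_le (ContinuousLinearMap.unit_le_opNorm _ x hx)

theorem not_separableSpace_strongDual [ProperSpace 𝕜] (hT : IsDispersingTree ε R C h E)
    (hε : 0 < ε) : ¬ SeparableSpace (StrongDual 𝕜 V) :=
  not_separableSpace_strongDual_of_isUnfragmented hε (range_nonempty h)
    (isBounded_iff_forall_norm_le.2 ⟨R, forall_mem_range.2 hT.norm_le⟩) hT.isUnfragmented_range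

theorem apply_eq_zero (hT : IsDispersingTree ε R C h E) {n : ℕ} {v : V} (hv : v ∈ E n)
    (hvn : ∀ i < n, h (i + 1) v = 0) (m : ℕ) : h m v = 0 := by
  induction m using Nat.strong_induction_on with
  | h m ih =>
    cases m with
    | zero => simp [hT.root]
    | succ m =>
      rcases lt_or_ge m n with hmn | hnm
      · exact hvn m hmn
      · rw [hT.eqOn m v (hT.monotone hnm hv), ih _ (Nat.lt_succ_of_le m.unpair_left_le)]

theorem strictMono (hT : IsDispersingTree ε R C h E) (hε : 0 ≤ ε) : StrictMono E := by
  refine strictMono_nat_of_lt_succ fun n => (hT.monotone n.le_succ).lt_of_not_ge fun hle => ?_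
  obtain ⟨x, hx, -, hgap⟩ := hT.exists_lt_norm n
  have : (h (n + 1) - h n.unpair.1) x = 0 := sub_eq_zero.2 (hT.eqOn n x (hle hx))
  rw [this, norm_zero] at hgap
  exact hgap.not_ge hε

theorem finrank_eq (hT : IsDispersingTree ε R C h E) (hε : 0 ≤ ε)
    (hsep : ∀ v, (∀ n, h n v = 0) → v = 0) (n : ℕ) : Module.finrank 𝕜 (E n) = n := by
  have hinj : ∀ n, Function.Injective
      ((LinearMap.pi fun i : Fin n => (h (i + 1)).toLinearMap).domRestrict (E n)) := fun n => by
    refine (injective_iff_map_eq_zero _).2 fun v hv => Subtype.ext (hsep v ?_)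
    exact hT.apply_eq_zero v.2 fun i hi => congr_fun hv ⟨i, hi⟩
  have hfin : ∀ n, FiniteDimensional 𝕜 (E n) := fun n => .of_injective _ (hinj n)
  have hmono : StrictMono fun n => Module.finrank 𝕜 (E n) := fun m n hmn =>
    Submodule.finrank_lt_finrank_of_lt (hT.strictMono hε hmn)
  refine le_antisymm ?_ (hmono.le_apply)
  simpa using LinearMap.finrank_le_finrank_of_injective (hinj n)

end Seminormed

theorem exists_schauderBasis {V : Type*} [NormedAddCommGroup V] [NormedSpace 𝕜 V]
    {h : ℕ → StrongDual 𝕜 V} {E : ℕ → Submodule 𝕜 V} (hT : IsDispersingTree ε R C h E)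
    (hε : 0 ≤ ε) (hC : 0 ≤ C) (hsep : ∀ v, (∀ n, h n v = 0) → v = 0) :
    ∃ b : SchauderBasis 𝕜 V, b.enormProjBound ≤ ENNReal.ofReal C :=
  exists_schauderBasis_of_isInterpolating hC (fun _ _ hmn => image_mono (Iic_subset_Iic.2 hmn))
    hT.monotone hT.isInterpolating
    (fun _ v hv hvn => hsep v (hT.apply_eq_zero hv fun i hi => hvn _ ⟨i + 1, hi, rfl⟩))
    (hT.finrank_eq hε hsep) hT.dense

end IsDispersingTree

theorem mainTheorem3_general {𝕜 : Type*} [RCLike 𝕜] {X : Type*} [NormedAddCommGroup X]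
    [NormedSpace 𝕜 X] [SeparableSpace X] (hXdual : ¬ SeparableSpace (StrongDual 𝕜 X)) {δ : ℝ}
    (hδ : 0 < δ) :
    ∃ (Y : Submodule 𝕜 X) (_ : IsClosed (Y : Set X)),
      ¬ SeparableSpace (StrongDual 𝕜 (X ⧸ Y)) ∧
      ∃ b : SchauderBasis 𝕜 (X ⧸ Y), b.enormProjBound ≤ ENNReal.ofReal (1 + δ) := by
  obtain ⟨ε, hε, R, h, E, hT⟩ := exists_isDispersingTree hXdual (C := 1 + δ / 2) (by linarith)
  let Y : Submodule 𝕜 X := ⨅ n, (h n).ker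
  have hYclosed : IsClosed (Y : Set X) := by
    rw [Submodule.coe_iInf]
    exact isClosed_iInter fun n => (h n).isClosed_ker
  have hTY := hT.quotient (by positivity) (by linarith : 1 + δ / 2 < 1 + δ) Y (iInf_le _)
  refine ⟨Y, hYclosed, hTY.not_separableSpace_strongDual hε,
    hTY.exists_schauderBasis hε.le (by positivity) fun v hv => ?_⟩
  obtain ⟨x, rfl⟩ := Y.mkQ_surjective v
  exact (Submodule.Quotient.mk_eq_zero Y).2 ((Submodule.mem_iInf _).2 hv)

theorem mainTheorem3 {𝕜 : Type*} [RCLike 𝕜]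
    {X : Type*} [NormedAddCommGroup X] [NormedSpace 𝕜 X] [CompleteSpace X]
    (hX : TopologicalSpace.SeparableSpace X)
    (hXdual : ¬ TopologicalSpace.SeparableSpace (StrongDual 𝕜 X))
    (δ : ℝ) (hδ : 0 < δ) :
    ∃ (Y : Submodule 𝕜 X) (_ : IsClosed (Y : Set X)),
      ¬ TopologicalSpace.SeparableSpace (StrongDual 𝕜 (X ⧸ Y)) ∧
      ∃ b : SchauderBasis 𝕜 (X ⧸ Y), b.enormProjBound ≤ ENNReal.ofReal (1 + δ) :=
  mainTheorem3_general hXdual hδ
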